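/- **Theorem (modified Helmholtz west/east low-rank factorization).** Let $\beta,d,\eta>0$, let $K_0(z)=\int_0^\infty e^{-z\cosh\tau}\,d\tau$ be the modified Bessel function of the second kind, and let $G(t,s)=\frac1{2\pi}K_0(\beta\|t-s\|)$ be the free-space Green's function. For $\xi\in\mathbb R$ put $\hat e_1=(d,0)$, $\hat e_2=(\xi,\eta)$, $l_{mn}=m\hat e_1+n\hat e_2$ and $\mathcal C=\{a\hat e_1+b\hat e_2:\ a,b\in[-\tfrac12,\tfrac12]\}$. In the singly periodic case take $\xi=0$ (rectangular cell); in the doubly periodic case assume $d\ge\sqrt{\xi^2+\eta^2}$. Let $$K_1^{west}(t,s)=\sum_{m\le-2}G(t,s+(md,0)),\qquad K_1^{east}(t,s)=\sum_{m\ge2}G(t,s+(md,0)),$$ $$K_2^{west}(t,s)=\sum_{n=-1}^{1}\sum_{m\le-4}G(t,s+l_{mn}),\qquad K_2^{east}(t,s)=\sum_{n=-1}^{1}\sum_{m\ge4}G(t,s+l_{mn}).$$ Write $\chi(\lambda)=\sqrt{\lambda^2+\beta^2}$, $B(\lambda)=e^{-\chi(\lambda)\xi+i\lambda\eta}+e^{\chi(\lambda)\xi-i\lambda\eta}+1$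 and, for $t=(x,y)$, $s=(x',y')$, $$F_1(\lambda;t,s)=\frac{e^{-\chi(\lambda)(x-x')}}{2\pi\chi(\lambda)}e^{i\lambda(y-y')}\frac{e^{-2\chi(\lambda)d}}{1-e^{-\chi(\lambda)d}},\qquad F_2(\lambda;t,s)=\frac{e^{-\chi(\lambda)(x-x')}}{2\pi\chi(\lambda)}e^{i\lambda(y-y')}\frac{e^{-4\chi(\lambda)d}}{1-e^{-\chi(\lambda)d}}B(\lambda).$$ For $k=1,2$, we say that real nodes $\lambda_1,\dots,\lambda_N$ and real weights $w_1,\dots,w_N$ have *precision* $\varepsilon$ for $F_k$ if $$\Big|\Re\int_0^\infty F_k(\lambda;t,s)\,d\lambda-\Re\sum_{n=1}^N w_nF_k(\lambda_n;t,s)\Big|\le\varepsilon\qquad\text{for all }t,s\in\mathcal C.$$ Then the following hold in each of the two cases ($k=1$ singly periodic, $k=2$ doubly periodic). 1. For all $t,s\in\mathcal C$, the series defining $K_k^{west}(t,s)$ and $K_k^{east}(t,s)$ converge absolutely and $F_k(\cdot\,;t,s)$ is integrable on $(0,\infty)$. 2. For every $\varepsilon>0$ there are finitely many nodes $\lambda_n\ge0$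 and real weights $w_n$ of precision $\varepsilon$ for $F_k$; for $k=2$ they can be chosen to depend only on $\varepsilon,\beta,d,\eta$, having precision $\varepsilon$ for every admissible $\xi$ simultaneously. 3. Let $\varepsilon>0$, let $\lambda_n,w_n$ ($n=1,\dots,N$) be any nodes and weights of precision $\varepsilon$ for $F_k$, and let $t_l=(x_l,y_l)$ ($l=1,\dots,N_T$) and $s_j=(x'_j,y'_j)$ ($j=1,\dots,N_S$) be any points of $\mathcal C$. Let $P_k^{west}(l,j)=K_k^{west}(t_l,s_j)$, $P_k^{east}(l,j)=K_k^{east}(t_l,s_j)$, and, with $\chi_n=\chi(\lambda_n)$, $$L^{west}(l,n)=e^{-\chi_nx_l}e^{i\lambda_ny_l},\quad R^{west}(n,j)=e^{\chi_nx'_j}e^{-i\lambda_ny'_j},\quad L^{east}(l,n)=e^{\chi_nx_l}e^{i\lambda_ny_l},\quad R^{east}(n,j)=e^{-\chi_nx'_j}e^{-i\lambda_ny'_j}.$$ Let $D_1^{west}=D_1^{east}$, $D_2^{west}$ and $D_2^{east}=\overline{D_2^{west}}$ be the diagonal matrices with $$D_1^{west}(n,n)=\frac1{2\pi}\frac{w_n}{\chi_n}\frac{e^{-2\chi_nd}}{1-e^{-\chi_nd}},\qquad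 D_2^{west}(n,n)=\frac{w_n}{\chi_n}\frac{e^{-4\chi_nd}}{1-e^{-\chi_nd}}\frac{B(\lambda_n)}{2\pi}.$$ Then, for each side $*\in\{west,east\}$, every $l,j$ and every $q\in\mathbb R^{N_S}$, $$\big|P_k^{*}(l,j)-\Re\,(L^{*}D_k^{*}R^{*})(l,j)\big|\le\varepsilon,\qquad \Big|(P_k^{*}q)_l-\Re\,\big(L^{*}D_k^{*}R^{*}q\big)_l\Big|\le\varepsilon\sum_{j=1}^{N_S}|q_j|.$$ That is, the real part of $L^{*}D_k^{*}R^{*}q$ is, to precision $\varepsilon$, the contribution of the west (respectively east) images to the periodizing potential. -/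

import Mathlib

open scoped Matrix

noncomputable section

namespace PeriodicHelmholtz

/-- Points of the plane with the Euclidean norm; `t 0`, `t 1` are the coordinates. -/
abbrev Plane : Type := EuclideanSpace ℝ (Fin 2)

/-- Modified Bessel function of the second kind of order zero, for `z > 0`,
`K₀(z) = ∫₀^∞ exp (-z cosh τ) dτ`. -/
def besselK0 (z : ℝ) : ℝ := ∫ τ in Set.Ioi (0 : ℝ), Real.exp (-z * Real.cosh τ)

/-- Free-space Green's function of the modified Helmholtz equation,
`G(t, s) = K₀(β ‖t - s‖) / (2π)`. -/
def green (β : ℝ) (t s : Plane) : ℝ := 1 / (2 * Real.pi) * besselK0 (β * ‖t - s‖)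

/-- First lattice vector. -/
def e₁ (d : ℝ) : Plane := !₂[d, 0]

/-- Second lattice vector. -/
def e₂ (ξ η : ℝ) : Plane := !₂[ξ, η]

/-- The lattice point `l_{mn} = m e₁ + n e₂`. -/
def latticePoint (d ξ η : ℝ) (m n : ℤ) : Plane := (m : ℝ) • e₁ d + (n : ℝ) • e₂ ξ η

/-- The unit cell, centred at the origin. It is a rectangle when `ξ = 0`. -/
def unitCell (d ξ η : ℝ) : Set Plane :=
  {p | ∃ a ∈ Set.Icc (-1 / 2 : ℝ) (1 / 2), ∃ b ∈ Set.Icc (-1 / 2 : ℝ) (1 / 2),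
    p = a • e₁ d + b • e₂ ξ η}

/-- One image term `G(t, s + l_{mn})`. -/
def imageTerm (β d ξ η : ℝ) (t s : Plane) (m n : ℤ) : ℝ :=
  green β t (s + latticePoint d ξ η m n)

/-- Singly periodic west kernel: images translated by `(m d, 0)`, `m ≤ -2`. -/
def K1west (β d : ℝ) (t s : Plane) : ℝ :=
  ∑' m : Set.Iic (-2 : ℤ), green β t (s + ((m : ℤ) : ℝ) • e₁ d)

/-- Singly periodic east kernel: images translated by `(m d, 0)`, `m ≥ 2`. -/
def K1east (β d : ℝ) (t s : Plane) : ℝ :=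
  ∑' m : Set.Ici (2 : ℤ), green β t (s + ((m : ℤ) : ℝ) • e₁ d)

/-- Doubly periodic west kernel: images `m ≤ -4`, `n = -1, 0, 1`. -/
def K2west (β d ξ η : ℝ) (t s : Plane) : ℝ :=
  ∑ n ∈ Finset.Icc (-1 : ℤ) 1, ∑' m : Set.Iic (-4 : ℤ), imageTerm β d ξ η t s m n

/-- Doubly periodic east kernel: images `m ≥ 4`, `n = -1, 0, 1`. -/
def K2east (β d ξ η : ℝ) (t s : Plane) : ℝ :=
  ∑ n ∈ Finset.Icc (-1 : ℤ) 1, ∑' m : Set.Ici (4 : ℤ), imageTerm β d ξ η t s m n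

/-- The operator `P(l, j) = K(t_l, s_j)` of a kernel. -/
def kernelMatrix {NT NS : ℕ} (K : Plane → Plane → ℝ) (T : Fin NT → Plane) (S : Fin NS → Plane) :
    Matrix (Fin NT) (Fin NS) ℝ :=
  Matrix.of fun l j => K (T l) (S j)

/-- `χ(μ) = √(μ² + β²)`. -/
def chi (β μ : ℝ) : ℝ := Real.sqrt (μ ^ 2 + β ^ 2)

/-- The geometric-series factor `e^{-kχd} / (1 - e^{-χd})`. -/
def geomFactor (β d : ℝ) (k : ℕ) (μ : ℝ) : ℝ :=
  Real.exp (-(k : ℝ) * chi β μ * d) / (1 - Real.exp (-(chi β μ) * d))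

/-- The sum over the three rows, `e^{-χξ + iμη} + e^{χξ - iμη} + 1`. -/
def rowFactor (β ξ η μ : ℝ) : ℂ :=
  Complex.exp (-((chi β μ : ℝ) : ℂ) * ξ + Complex.I * μ * η)
    + Complex.exp (((chi β μ : ℝ) : ℂ) * ξ - Complex.I * μ * η) + 1

/-- The integrand, over `μ ∈ (0, ∞)`, of the Sommerfeld representation of `K1west`. -/
def westIntegrand1 (β d : ℝ) (t s : Plane) (μ : ℝ) : ℂ :=
  ((Real.exp (-(chi β μ) * (t 0 - s 0)) / (2 * Real.pi * chi β μ) : ℝ) : ℂ)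
    * Complex.exp (Complex.I * μ * ((t 1 - s 1 : ℝ) : ℂ))
    * (geomFactor β d 2 μ : ℂ)

/-- The integrand, over `μ ∈ (0, ∞)`, of the Sommerfeld representation of `K2west`. -/
def westIntegrand2 (β d ξ η : ℝ) (t s : Plane) (μ : ℝ) : ℂ :=
  ((Real.exp (-(chi β μ) * (t 0 - s 0)) / (2 * Real.pi * chi β μ) : ℝ) : ℂ)
    * Complex.exp (Complex.I * μ * ((t 1 - s 1 : ℝ) : ℂ))
    * (geomFactor β d 4 μ : ℂ) * rowFactor β ξ η μ

/-- Nodes `lam` and weights `w` discretize `Re ∫₀^∞ F(t, s, μ) dμ` to precision `ε`, uniformly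
for targets and sources in `C`. -/
def HasPrecision (C : Set Plane) (F : Plane → Plane → ℝ → ℂ) (ε : ℝ) {N : ℕ}
    (lam w : Fin N → ℝ) : Prop :=
  ∀ t ∈ C, ∀ s ∈ C,
    |(∫ μ in Set.Ioi (0 : ℝ), F t s μ).re - (∑ n, (w n : ℂ) * F t s (lam n)).re| ≤ ε

/-- `L^{west}(l, n) = e^{-χ_n x_l} e^{i λ_n y_l}`. -/
def Lwest {NT N : ℕ} (β : ℝ) (lam : Fin N → ℝ) (T : Fin NT → Plane) :
    Matrix (Fin NT) (Fin N) ℂ :=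
  Matrix.of fun l n => (Real.exp (-(chi β (lam n)) * T l 0) : ℂ)
    * Complex.exp (Complex.I * lam n * (T l 1 : ℂ))

/-- `R^{west}(n, j) = e^{χ_n x'_j} e^{-i λ_n y'_j}`. -/
def Rwest {NS N : ℕ} (β : ℝ) (lam : Fin N → ℝ) (S : Fin NS → Plane) :
    Matrix (Fin N) (Fin NS) ℂ :=
  Matrix.of fun n j => (Real.exp (chi β (lam n) * S j 0) : ℂ)
    * Complex.exp (-Complex.I * lam n * (S j 1 : ℂ))

/-- `L^{east}(l, n) = e^{χ_n x_l} e^{i λ_n y_l}`. -/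
def Least {NT N : ℕ} (β : ℝ) (lam : Fin N → ℝ) (T : Fin NT → Plane) :
    Matrix (Fin NT) (Fin N) ℂ :=
  Matrix.of fun l n => (Real.exp (chi β (lam n) * T l 0) : ℂ)
    * Complex.exp (Complex.I * lam n * (T l 1 : ℂ))

/-- `R^{east}(n, j) = e^{-χ_n x'_j} e^{-i λ_n y'_j}`. -/
def Reast {NS N : ℕ} (β : ℝ) (lam : Fin N → ℝ) (S : Fin NS → Plane) :
    Matrix (Fin N) (Fin NS) ℂ :=
  Matrix.of fun n j => (Real.exp (-(chi β (lam n)) * S j 0) : ℂ)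
    * Complex.exp (-Complex.I * lam n * (S j 1 : ℂ))

/-- `D₁^{e/w}(n, n) = (1 / 2π) (w_n / χ_n) e^{-2χ_n d} / (1 - e^{-χ_n d})`. -/
def D1 {N : ℕ} (β d : ℝ) (lam w : Fin N → ℝ) : Matrix (Fin N) (Fin N) ℂ :=
  Matrix.diagonal fun n =>
    ((1 / (2 * Real.pi) * (w n / chi β (lam n)) * geomFactor β d 2 (lam n) : ℝ) : ℂ)

/-- `D₂^{west}(n, n) = (w_n / χ_n) (e^{-4χ_n d} / (1 - e^{-χ_n d}))
[e^{-χ_n ξ + iλ_n η} + e^{χ_n ξ - iλ_n η} + 1] / (2π)`. -/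
def D2west {N : ℕ} (β d ξ η : ℝ) (lam w : Fin N → ℝ) : Matrix (Fin N) (Fin N) ℂ :=
  Matrix.diagonal fun n =>
    ((w n / chi β (lam n) * geomFactor β d 4 (lam n) : ℝ) : ℂ)
      * (rowFactor β ξ η (lam n) / (2 * (Real.pi : ℂ)))

/-- `D₂^{east}`, the entrywise complex conjugate of `D₂^{west}`. -/
def D2east {N : ℕ} (β d ξ η : ℝ) (lam w : Fin N → ℝ) : Matrix (Fin N) (Fin N) ℂ :=
  (D2west β d ξ η lam w).map (starRingEnd ℂ)

/-- The real part of the complex matrix `A` represents the real operator `P` to precision `ε`: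
entrywise, and on every vector `q` of charges, where the error in the potential `P q` at each
target is at most `ε ∑ |q_j|`. -/
def RepresentsRe {NT NS : ℕ} (P : Matrix (Fin NT) (Fin NS) ℝ) (A : Matrix (Fin NT) (Fin NS) ℂ)
    (ε : ℝ) : Prop :=
  (∀ l j, |P l j - (A l j).re| ≤ ε) ∧
    ∀ (q : Fin NS → ℝ) (l : Fin NT),
      |(P *ᵥ q) l - ((A *ᵥ fun j => (q j : ℂ)) l).re| ≤ ε * ∑ j, |q j|

end PeriodicHelmholtz

end

noncomputable section

namespace PeriodicHelmholtz

open MeasureTheory Set Filter Topology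

/-! ### The Sommerfeld representation of `K₀` -/

/-! For X > 0 the Sommerfeld formula K₀(β√(X² + Y²)) = ∫₀^∞ e^{-χX} cos(μY)/χ dμ writes the Green's
function as a superposition of waves decaying in X. It is obtained by tilting the defining integral
of K₀ through the angle arg(X + iY), which leaves the value unchanged (`integral_rotatedIntegrand`),
and substituting μ = β sinh τ (`besselK0_eq_integral_chi`).

Moving an image one period west multiplies its wave by e^{-χd} ≤ e^{-βd} < 1. A row of images is
therefore a geometric series that may be summed under the integral (`hasSum_integral_planeWave`);
the rows above and below contribute the remaining terms of B. The east sums are west sums with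
target and source exchanged.

Existence of quadratures is soft: the integral of a Banach-valued function lies in the closed span
of its values (`integral_mem_topologicalClosure_span`). With values in C(K, ℝ), for a compact
rectangle K of offsets x - x', y - y' (shifted) that stays away from X = 0, this gives one finite
rule uniformly accurate on K. In the doubly periodic case K can be chosen independent of ξ.

Finally, each entry of L D R for the west is exactly the quadrature sum of the integrand, because
the waves separate in t and s. The east product is the conjugate transpose of the west one with
targets and sources exchanged, so its real part inherits the same error. -/

lemma self_le_cosh (τ : ℝ) (hτ : 0 ≤ τ) : τ ≤ Real.cosh τ :=
  (Real.self_le_sinh_iff.2 hτ).trans (Real.sinh_lt_cosh τ).le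

/-- Half of the exponent absorbs the factor cosh τ, through x ≤ e^x at x = (a/2) cosh τ; the other
half still decays exponentially in τ. -/
lemma cosh_mul_exp_le {a τ : ℝ} (ha : 0 < a) (hτ : 0 ≤ τ) :
    Real.cosh τ * Real.exp (-a * Real.cosh τ) ≤ 2 / a * Real.exp (-(a / 2) * τ) := by
  have h1 : a / 2 * Real.cosh τ ≤ Real.exp (a / 2 * Real.cosh τ) := by
    linarith [Real.add_one_le_exp (a / 2 * Real.cosh τ)]
  have h2 : Real.cosh τ ≤ 2 / a * Real.exp (a / 2 * Real.cosh τ) := by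
    calc Real.cosh τ = 2 / a * (a / 2 * Real.cosh τ) := by field_simp
      _ ≤ _ := by gcongr
  calc Real.cosh τ * Real.exp (-a * Real.cosh τ)
      ≤ 2 / a * Real.exp (a / 2 * Real.cosh τ) * Real.exp (-a * Real.cosh τ) := by gcongr
    _ = 2 / a * Real.exp (-(a / 2) * Real.cosh τ) := by
        rw [mul_assoc, ← Real.exp_add]; ring_nf
    _ ≤ _ := by
        gcongr 2 / a * Real.exp ?_
        nlinarith [self_le_cosh τ hτ]

lemma integrableOn_cosh_mul_exp {a : ℝ} (ha : 0 < a) :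
    IntegrableOn (fun τ => Real.cosh τ * Real.exp (-a * Real.cosh τ)) (Ioi 0) := by
  refine Integrable.mono' ((exp_neg_integrableOn_Ioi 0 (half_pos ha)).const_mul (2 / a))
    (by fun_prop) ?_
  filter_upwards [ae_restrict_mem measurableSet_Ioi] with τ hτ
  rw [Real.norm_of_nonneg (by positivity)]
  exact cosh_mul_exp_le ha (le_of_lt hτ)

lemma integrableOn_exp_neg_cosh_mul {a : ℝ} (ha : 0 < a) {g : ℝ → ℝ} (hg : Continuous g)
    (hb : ∀ τ, |g τ| ≤ 1) :
    IntegrableOn (fun τ => Real.exp (-a * Real.cosh τ) * g τ) (Ioi 0) := by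
  refine Integrable.mono' (integrableOn_cosh_mul_exp ha) (by fun_prop) (ae_of_all _ fun τ => ?_)
  rw [norm_mul, Real.norm_of_nonneg (Real.exp_nonneg _), Real.norm_eq_abs, mul_comm]
  gcongr
  exact (hb τ).trans (Real.one_le_cosh τ)

/-- The integrand `Re exp (-r cosh (τ - iθ))` of the rotated integral. -/
def rotatedIntegrand (r θ τ : ℝ) : ℝ :=
  Real.exp (-(r * Real.cos θ) * Real.cosh τ) * Real.cos (r * Real.sin θ * Real.sinh τ)

/-- The derivative of `rotatedIntegrand` in the angle. -/
def rotatedIntegrandDeriv (r θ τ : ℝ) : ℝ :=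
  Real.exp (-(r * Real.cos θ) * Real.cosh τ) *
    (r * Real.sin θ * Real.cosh τ * Real.cos (r * Real.sin θ * Real.sinh τ)
      - r * Real.cos θ * Real.sinh τ * Real.sin (r * Real.sin θ * Real.sinh τ))

lemma hasDerivAt_rotatedIntegrand (r θ τ : ℝ) :
    HasDerivAt (fun θ => rotatedIntegrand r θ τ) (rotatedIntegrandDeriv r θ τ) θ := by
  have h1 := ((((Real.hasDerivAt_cos θ).const_mul r).neg).mul_const (Real.cosh τ)).exp
  have h2 := (((Real.hasDerivAt_sin θ).const_mul r).mul_const (Real.sinh τ)).cos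
  refine (h1.mul h2).congr_deriv ?_
  simp only [rotatedIntegrandDeriv, Pi.neg_apply]
  ring

/-- Cauchy–Riemann for f(τ - iθ) with f(z) = exp(-r cosh z): ∂_θ Re f = ∂_τ Im f. The angular
derivative is thus exact in τ. -/
lemma hasDerivAt_rotatedIntegrand_conj (r θ τ : ℝ) :
    HasDerivAt (fun τ => Real.exp (-(r * Real.cos θ) * Real.cosh τ) *
      Real.sin (r * Real.sin θ * Real.sinh τ)) (rotatedIntegrandDeriv r θ τ) τ := by
  have h1 := ((Real.hasDerivAt_cosh τ).const_mul (-(r * Real.cos θ))).exp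
  have h2 := ((Real.hasDerivAt_sinh τ).const_mul (r * Real.sin θ)).sin
  refine (h1.mul h2).congr_deriv ?_
  simp only [rotatedIntegrandDeriv]
  ring

lemma abs_rotatedIntegrandDeriv_le {r θ c : ℝ} (hr : 0 < r) (hc : c ≤ Real.cos θ) (τ : ℝ) :
    |rotatedIntegrandDeriv r θ τ| ≤
      2 * r * (Real.cosh τ * Real.exp (-(r * c) * Real.cosh τ)) := by
  have hC : 0 < Real.cosh τ := Real.cosh_pos τ
  have hS : |Real.sinh τ| ≤ Real.cosh τ := by
    rw [← Real.cosh_abs, Real.abs_sinh]; exact (Real.sinh_lt_cosh _).le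
  have h1 : |r * Real.sin θ * Real.cosh τ * Real.cos (r * Real.sin θ * Real.sinh τ)|
      ≤ r * 1 * Real.cosh τ * 1 := by
    rw [abs_mul, abs_mul, abs_mul, abs_of_pos hr, abs_of_pos hC]
    gcongr
    · exact Real.abs_sin_le_one _
    · exact Real.abs_cos_le_one _
  have h2 : |r * Real.cos θ * Real.sinh τ * Real.sin (r * Real.sin θ * Real.sinh τ)|
      ≤ r * 1 * Real.cosh τ * 1 := by
    rw [abs_mul, abs_mul, abs_mul, abs_of_pos hr]
    gcongr
    · exact Real.abs_cos_le_one _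
    · exact Real.abs_sin_le_one _
  rw [rotatedIntegrandDeriv, abs_mul, Real.abs_exp]
  calc _ ≤ Real.exp (-(r * c) * Real.cosh τ) * (r * 1 * Real.cosh τ * 1 + r * 1 * Real.cosh τ * 1)
        := by
        gcongr
        exact (abs_sub _ _).trans (add_le_add h1 h2)
    _ = _ := by ring

lemma integrableOn_rotatedIntegrand {r θ : ℝ} (hr : 0 < r) (hθ : 0 < Real.cos θ) :
    IntegrableOn (rotatedIntegrand r θ) (Ioi 0) :=
  integrableOn_exp_neg_cosh_mul (mul_pos hr hθ) (by fun_prop) fun _ => Real.abs_cos_le_one _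

lemma integrableOn_rotatedIntegrandDeriv {r θ : ℝ} (hr : 0 < r) (hθ : 0 < Real.cos θ) :
    IntegrableOn (rotatedIntegrandDeriv r θ) (Ioi 0) := by
  refine Integrable.mono' ((integrableOn_cosh_mul_exp (mul_pos hr hθ)).const_mul (2 * r)) ?_
    (ae_of_all _ (abs_rotatedIntegrandDeriv_le hr le_rfl))
  unfold rotatedIntegrandDeriv
  fun_prop

lemma integral_rotatedIntegrandDeriv {r θ : ℝ} (hr : 0 < r) (hθ : 0 < Real.cos θ) :
    ∫ τ in Ioi 0, rotatedIntegrandDeriv r θ τ = 0 := by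
  have hrc := mul_pos hr hθ
  -- Both boundary values of the primitive vanish: at 0 because sinh 0 = 0, at infinity because cos
  -- θ > 0 forces decay.
  have key := integral_Ioi_of_hasDerivAt_of_tendsto' (a := (0 : ℝ)) (m := (0 : ℝ))
    (fun τ _ => hasDerivAt_rotatedIntegrand_conj r θ τ)
    (integrableOn_rotatedIntegrandDeriv hr hθ) ?_
  · simpa using key
  · have h0 : Tendsto (fun τ : ℝ => Real.exp (-(r * Real.cos θ) * τ)) atTop (𝓝 0) :=
      Real.tendsto_exp_atBot.comp (tendsto_id.const_mul_atTop_of_neg (neg_neg_of_pos hrc))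
    refine squeeze_zero_norm' ?_ h0
    filter_upwards [eventually_ge_atTop 0] with τ hτ
    rw [norm_mul, Real.norm_of_nonneg (Real.exp_nonneg _), Real.norm_eq_abs, ← mul_one (Real.exp (_ * τ))]
    gcongr ?_ * ?_
    · rw [Real.exp_le_exp]
      nlinarith [self_le_cosh τ hτ]
    · exact Real.abs_sin_le_one _

lemma hasDerivAt_integral_rotatedIntegrand {r θ : ℝ} (hr : 0 < r) (hθ : 0 < Real.cos θ) :
    HasDerivAt (fun θ => ∫ τ in Ioi 0, rotatedIntegrand r θ τ) 0 θ := by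
  -- On this neighbourhood the decay rate r cos x is at least r cos θ / 2, so a single integrable
  -- function dominates all the derivatives.
  have hs : {x | Real.cos θ / 2 ≤ Real.cos x} ∈ 𝓝 θ :=
    (Real.continuous_cos.tendsto θ).eventually_const_le (half_lt_self hθ)
  refine ((hasDerivAt_integral_of_dominated_loc_of_deriv_le hs
    (Eventually.of_forall fun x => ?_) (integrableOn_rotatedIntegrand hr hθ)
    (integrableOn_rotatedIntegrandDeriv hr hθ).1
    (ae_of_all _ fun τ x hx => abs_rotatedIntegrandDeriv_le hr hx τ)
    ((integrableOn_cosh_mul_exp (mul_pos hr (half_pos hθ))).const_mul (2 * r))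
    (ae_of_all _ fun τ x _ => hasDerivAt_rotatedIntegrand r x τ)).2).congr_deriv
    (integral_rotatedIntegrandDeriv hr hθ)
  unfold rotatedIntegrand
  fun_prop

lemma integral_rotatedIntegrand {r θ : ℝ} (hr : 0 < r) (hθ : |θ| < Real.pi / 2) :
    ∫ τ in Ioi 0, rotatedIntegrand r θ τ = besselK0 r := by
  have hcos : ∀ x ∈ Ioo (-(Real.pi / 2)) (Real.pi / 2), 0 < Real.cos x :=
    fun x hx => Real.cos_pos_of_mem_Ioo hx
  have hd := fun x hx => hasDerivAt_integral_rotatedIntegrand hr (hcos x hx)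
  have h := isOpen_Ioo.is_const_of_deriv_eq_zero isPreconnected_Ioo
    (fun x hx => (hd x hx).differentiableAt.differentiableWithinAt)
    (fun x hx => (hd x hx).deriv) (abs_lt.1 hθ)
    (show (0 : ℝ) ∈ _ from ⟨by linarith [Real.pi_pos], by linarith [Real.pi_pos]⟩)
  simpa [rotatedIntegrand, besselK0] using h

lemma besselK0_eq_integral_cosh {β X Y : ℝ} (hβ : 0 < β) (hX : 0 < X) :
    besselK0 (β * Real.sqrt (X ^ 2 + Y ^ 2)) =
      ∫ τ in Ioi 0, Real.exp (-(β * X) * Real.cosh τ) * Real.cos (β * Y * Real.sinh τ) := by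
  set z : ℂ := ⟨X, Y⟩
  have hz : ‖z‖ = Real.sqrt (X ^ 2 + Y ^ 2) := by
    rw [Complex.norm_eq_sqrt_sq_add_sq]
  have hz0 : 0 < ‖z‖ := by rw [hz]; positivity
  -- The rotation angle is the argument of X + iY; X > 0 keeps it inside (-π/2, π/2).
  have hc : ‖z‖ * Real.cos z.arg = X := Complex.norm_mul_cos_arg z
  have hs : ‖z‖ * Real.sin z.arg = Y := Complex.norm_mul_sin_arg z
  rw [← hz, ← integral_rotatedIntegrand (mul_pos hβ hz0)
    (Complex.abs_arg_lt_pi_div_two_iff.2 (Or.inl (show 0 < z.re from hX)))]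
  simp only [rotatedIntegrand, mul_assoc, hc, hs]

/-! ### The function χ and the substitution μ = β sinh τ. -/

lemma chi_pos {β : ℝ} (hβ : 0 < β) (μ : ℝ) : 0 < chi β μ := by
  unfold chi; positivity

lemma continuous_chi (β : ℝ) : Continuous (chi β) := by
  unfold chi; fun_prop

lemma self_le_chi (β μ : ℝ) : μ ≤ chi β μ :=
  Real.le_sqrt_of_sq_le (by nlinarith [sq_nonneg β])

lemma le_chi (β μ : ℝ) : β ≤ chi β μ :=
  Real.le_sqrt_of_sq_le (by nlinarith [sq_nonneg μ])

lemma chi_mul_sinh {β : ℝ} (hβ : 0 < β) (τ : ℝ) :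
    chi β (β * Real.sinh τ) = β * Real.cosh τ := by
  rw [chi, show (β * Real.sinh τ) ^ 2 + β ^ 2 = (β * Real.cosh τ) ^ 2 by
    rw [mul_pow, mul_pow, Real.cosh_sq]; ring]
  exact Real.sqrt_sq (by positivity)

lemma image_mul_sinh_Ioi {β : ℝ} (hβ : 0 < β) :
    (fun τ => β * Real.sinh τ) '' Ioi 0 = Ioi 0 := by
  ext μ
  constructor
  · rintro ⟨τ, hτ, rfl⟩
    exact mul_pos hβ (Real.sinh_pos_iff.2 hτ)
  · intro hμ
    refine ⟨Real.arsinh (μ / β), Real.arsinh_pos_iff.2 (div_pos hμ hβ), ?_⟩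
    simp only [Real.sinh_arsinh]
    field_simp

lemma besselK0_eq_integral_chi {β X Y : ℝ} (hβ : 0 < β) (hX : 0 < X) :
    besselK0 (β * Real.sqrt (X ^ 2 + Y ^ 2)) =
      ∫ μ in Ioi 0, Real.exp (-(chi β μ) * X) / chi β μ * Real.cos (μ * Y) := by
  have h := integral_image_eq_integral_abs_deriv_smul (s := Ioi (0 : ℝ)) measurableSet_Ioi
    (fun τ _ => ((Real.hasDerivAt_sinh τ).const_mul β).hasDerivWithinAt)
    (fun a _ b _ hab => Real.sinh_injective (mul_left_cancel₀ hβ.ne' hab))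
    (fun μ => Real.exp (-(chi β μ) * X) / chi β μ * Real.cos (μ * Y))
  rw [image_mul_sinh_Ioi hβ] at h
  rw [h, besselK0_eq_integral_cosh hβ hX]
  refine setIntegral_congr_fun measurableSet_Ioi fun τ _ => ?_
  have hC := Real.cosh_pos τ
  simp only [smul_eq_mul, chi_mul_sinh hβ]
  rw [abs_of_pos (by positivity)]
  rw [show β * Y * Real.sinh τ = β * Real.sinh τ * Y by ring,
    show -(β * X) * Real.cosh τ = -(β * Real.cosh τ) * X by ring]
  field_simp

lemma green_comm (β : ℝ) (t s : Plane) : green β t s = green β s t := by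
  rw [green, green, norm_sub_rev]

lemma green_eq_integral {β : ℝ} (hβ : 0 < β) {t s : Plane} (h : s 0 < t 0) :
    green β t s = ∫ μ in Ioi 0, Real.exp (-(chi β μ) * (t 0 - s 0)) / (2 * Real.pi * chi β μ)
      * Real.cos (μ * (t 1 - s 1)) := by
  have hn : ‖t - s‖ = Real.sqrt ((t 0 - s 0) ^ 2 + (t 1 - s 1) ^ 2) := by
    simp [EuclideanSpace.norm_eq, Fin.sum_univ_two]
  rw [green, hn, besselK0_eq_integral_chi hβ (sub_pos.2 h), ← integral_const_mul]
  congr 1 with μ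
  have := chi_pos hβ μ
  field_simp

/-! ### Geometric sums of plane waves -/

lemma exp_neg_chi_mul_lt_one {β d : ℝ} (hβ : 0 < β) (hd : 0 < d) (μ : ℝ) :
    Real.exp (-(chi β μ) * d) < 1 :=
  Real.exp_lt_one_iff.2 (by nlinarith [chi_pos hβ μ])

/-- The amplitude of a sum of evanescent plane waves, `e^{-χX} / (2πχ (1 - e^{-χd}))`. -/
def waveAmplitude (β d X μ : ℝ) : ℝ :=
  Real.exp (-(chi β μ) * X) / (2 * Real.pi * chi β μ) / (1 - Real.exp (-(chi β μ) * d))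

lemma waveAmplitude_nonneg {β d : ℝ} (hβ : 0 < β) (hd : 0 < d) (X μ : ℝ) :
    0 ≤ waveAmplitude β d X μ := by
  have := chi_pos hβ μ
  have := exp_neg_chi_mul_lt_one hβ hd μ
  exact div_nonneg (by positivity) (by linarith)

/-- χ ≥ μ supplies the decay and χ ≥ β bounds both denominators. The bound is uniform over X ≥ c,
which later makes a C(K, ℝ)-valued function integrable. -/
lemma waveAmplitude_le {β d X c μ : ℝ} (hβ : 0 < β) (hd : 0 < d) (hc : 0 < c) (hX : c ≤ X) :
    waveAmplitude β d X μ ≤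
      1 / (2 * Real.pi * β * (1 - Real.exp (-β * d))) * Real.exp (-c * μ) := by
  have h0 := chi_pos hβ μ
  have h1 : Real.exp (-β * d) < 1 := Real.exp_lt_one_iff.2 (by nlinarith)
  have h2 := self_le_chi β μ
  have h3 := le_chi β μ
  rw [waveAmplitude, div_div, div_mul_eq_mul_div, one_mul]
  have h4 : -(chi β μ) * X ≤ -c * μ := by nlinarith
  have h5 : -(chi β μ) * d ≤ -β * d := by nlinarith
  have h6 : 0 < 1 - Real.exp (-β * d) := by linarith
  gcongr

lemma continuous_waveAmplitude_uncurry {β d : ℝ} (hβ : 0 < β) (hd : 0 < d) :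
    Continuous fun p : ℝ × ℝ => waveAmplitude β d p.1 p.2 := by
  have hc : Continuous fun p : ℝ × ℝ => chi β p.2 := (continuous_chi β).comp continuous_snd
  unfold waveAmplitude
  refine Continuous.div (Continuous.div (by fun_prop) (by fun_prop) fun p => ?_) (by fun_prop)
    fun p => ?_
  · have := chi_pos hβ p.2
    positivity
  · have := exp_neg_chi_mul_lt_one hβ hd p.2
    linarith

lemma continuous_waveAmplitude {β d : ℝ} (hβ : 0 < β) (hd : 0 < d) (X : ℝ) :
    Continuous (waveAmplitude β d X) :=
  (continuous_waveAmplitude_uncurry hβ hd).comp (Continuous.prodMk_right X)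

lemma integrableOn_waveAmplitude_smul {E : Type*} [NormedAddCommGroup E] [NormedSpace ℝ E]
    {β d X : ℝ} (hβ : 0 < β) (hd : 0 < d) (hX : 0 < X)
    {g : ℝ → E} (hg : Continuous g) (hb : ∀ μ, ‖g μ‖ ≤ 1) :
    IntegrableOn (fun μ => waveAmplitude β d X μ • g μ) (Ioi 0) := by
  refine Integrable.mono' ((exp_neg_integrableOn_Ioi 0 hX).const_mul
    (1 / (2 * Real.pi * β * (1 - Real.exp (-β * d)))))
    ((continuous_waveAmplitude hβ hd X).smul hg).aestronglyMeasurable (ae_of_all _ fun μ => ?_)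
  rw [norm_smul, Real.norm_of_nonneg (waveAmplitude_nonneg hβ hd X μ)]
  exact (mul_le_of_le_one_right (waveAmplitude_nonneg hβ hd X μ) (hb μ)).trans
    (waveAmplitude_le hβ hd hX le_rfl)

/-- The sum over `k` of the plane waves at offsets `(X + k d, Y)`. -/
def planeWave (β d X Y μ : ℝ) : ℂ :=
  waveAmplitude β d X μ • Complex.exp (Complex.I * μ * (Y : ℂ))

lemma norm_exp_I_mul_mul (μ Y : ℝ) : ‖Complex.exp (Complex.I * μ * (Y : ℂ))‖ = 1 := by
  rw [Complex.norm_exp]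
  simp

lemma re_planeWave (β d X Y μ : ℝ) :
    (planeWave β d X Y μ).re = waveAmplitude β d X μ * Real.cos (μ * Y) := by
  rw [planeWave, Complex.smul_re, smul_eq_mul, mul_assoc, mul_comm Complex.I, ← Complex.ofReal_mul,
    Complex.exp_ofReal_mul_I_re]

lemma integrableOn_planeWave {β d X : ℝ} (hβ : 0 < β) (hd : 0 < d) (hX : 0 < X) (Y : ℝ) :
    IntegrableOn (planeWave β d X Y) (Ioi 0) :=
  integrableOn_waveAmplitude_smul hβ hd hX (by fun_prop) fun μ => (norm_exp_I_mul_mul μ Y).le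

lemma integral_re_planeWave {β d X : ℝ} (hβ : 0 < β) (hd : 0 < d) (hX : 0 < X) (Y : ℝ) :
    (∫ μ in Ioi 0, planeWave β d X Y μ).re =
      ∫ μ in Ioi 0, waveAmplitude β d X μ * Real.cos (μ * Y) := by
  simp only [← re_planeWave]
  exact (integral_re (integrableOn_planeWave hβ hd hX Y)).symm

/-- Geometric series with ratio q = e^{-χd}, whose sum is the factor 1/(1 - q) in `waveAmplitude`.
Since q ≤ e^{-βd} < 1 uniformly in μ, the integrals of the norms are summable and sum and integral
commute. -/
lemma hasSum_integral_planeWave {β d X : ℝ} (hβ : 0 < β) (hd : 0 < d) (hX : 0 < X) (Y : ℝ) :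
    HasSum (fun k : ℕ => ∫ μ in Ioi 0,
        Real.exp (-(chi β μ) * (X + k * d)) / (2 * Real.pi * chi β μ) * Real.cos (μ * Y))
      (∫ μ in Ioi 0, planeWave β d X Y μ).re := by
  rw [integral_re_planeWave hβ hd hX]
  set q : ℝ → ℝ := fun μ => Real.exp (-(chi β μ) * d) with hq
  set F : ℕ → ℝ → ℝ := fun k μ =>
    Real.exp (-(chi β μ) * (X + k * d)) / (2 * Real.pi * chi β μ) * Real.cos (μ * Y) with hF
  -- The factor 1 - q cancels the denominator of the amplitude, so every term is dominated by the
  -- same integrable amplitude times q^k.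
  have hFeq : ∀ k μ, F k μ = waveAmplitude β d X μ *
      (Real.cos (μ * Y) * (1 - q μ) * q μ ^ k) := by
    intro k μ
    have h1 := chi_pos hβ μ
    have h2 : (1 - q μ) ≠ 0 := (sub_pos.2 (exp_neg_chi_mul_lt_one hβ hd μ)).ne'
    simp only [hF, waveAmplitude, ← Real.exp_nat_mul, hq] at h2 ⊢
    rw [show -(chi β μ) * (X + k * d) = -(chi β μ) * X + k * (-(chi β μ) * d) by ring, Real.exp_add]
    generalize 1 - Real.exp (-(chi β μ) * d) = a at h2 ⊢
    field_simp
  have hcont : Continuous q := by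
    have := continuous_chi β
    fun_prop
  have hq0 : ∀ μ, 0 ≤ q μ := fun μ => Real.exp_nonneg _
  have hq1 : ∀ μ, q μ < 1 := exp_neg_chi_mul_lt_one hβ hd
  have hqβ : ∀ μ, q μ ≤ Real.exp (-β * d) := fun μ =>
    Real.exp_le_exp.2 (by nlinarith [le_chi β μ])
  have hβ1 : Real.exp (-β * d) < 1 := Real.exp_lt_one_iff.2 (by nlinarith)
  have hb : ∀ μ, |Real.cos (μ * Y) * (1 - q μ)| ≤ 1 := fun μ => by
    rw [abs_mul]
    refine mul_le_one₀ (Real.abs_cos_le_one _) (abs_nonneg _) ?_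
    rw [abs_le]
    constructor <;> linarith [hq0 μ, hq1 μ]
  have hnorm : ∀ k μ, ‖F k μ‖ ≤ Real.exp (-β * d) ^ k * waveAmplitude β d X μ := by
    intro k μ
    have hA := waveAmplitude_nonneg hβ hd X μ
    have := pow_le_pow_left₀ (hq0 μ) (hqβ μ) k
    rw [hFeq, norm_mul, norm_mul, Real.norm_of_nonneg hA, Real.norm_eq_abs,
      Real.norm_of_nonneg (pow_nonneg (hq0 μ) k), mul_comm]
    gcongr
    exact (mul_le_of_le_one_left (pow_nonneg (hq0 μ) k) (hb μ)).trans this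
  have hAint : IntegrableOn (waveAmplitude β d X) (Ioi 0) := by
    simpa using integrableOn_waveAmplitude_smul hβ hd hX (g := fun _ => (1 : ℝ))
      continuous_const (by simp)
  have hint : ∀ k, IntegrableOn (F k) (Ioi 0) := fun k => by
    refine (hAint.const_mul (Real.exp (-β * d) ^ k)).mono' ?_ (ae_of_all _ (hnorm k))
    have hA := continuous_waveAmplitude hβ hd X
    rw [show F k = fun μ => _ from funext (hFeq k)]
    fun_prop
  have key := hasSum_integral_of_summable_integral_norm (F := F) hint ?_
  · have heq : ∫ μ in Ioi 0, ∑' k, F k μ =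
        ∫ μ in Ioi 0, waveAmplitude β d X μ * Real.cos (μ * Y) := by
      refine setIntegral_congr_fun measurableSet_Ioi fun μ _ => ?_
      have h2 : (1 - q μ) ≠ 0 := (sub_pos.2 (hq1 μ)).ne'
      simp only [hFeq]
      rw [tsum_mul_left, tsum_mul_left, tsum_geometric_of_lt_one (hq0 μ) (hq1 μ)]
      field_simp
    exact heq ▸ key
  · refine Summable.of_nonneg_of_le (fun k => integral_nonneg fun μ => norm_nonneg _)
      (fun k => ?_) ((summable_geometric_of_lt_one (Real.exp_nonneg _) hβ1).mul_right
        (∫ μ in Ioi 0, waveAmplitude β d X μ))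
    rw [← integral_const_mul]
    exact integral_mono (hint k).norm (hAint.const_mul _) (hnorm k)

/-! ### Rows of images -/

@[simp] lemma latticePoint_zero (d ξ η : ℝ) (m n : ℤ) :
    latticePoint d ξ η m n 0 = m * d + n * ξ := by
  simp [latticePoint, e₁, e₂]

@[simp] lemma latticePoint_one (d ξ η : ℝ) (m n : ℤ) : latticePoint d ξ η m n 1 = n * η := by
  simp [latticePoint, e₁, e₂]

lemma imageTerm_comm (β d ξ η : ℝ) (t s : Plane) (m n : ℤ) :
    imageTerm β d ξ η t s m n = imageTerm β d ξ η s t (-m) (-n) := by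
  rw [imageTerm, imageTerm, green_comm, green, green]
  congr 4
  simp only [latticePoint]
  push_cast
  module

lemma green_add_smul_e₁ (β d : ℝ) (t s : Plane) (m : ℤ) :
    green β t (s + (m : ℝ) • e₁ d) = imageTerm β d 0 0 t s m 0 := by
  simp [imageTerm, latticePoint]

/-- The natural numbers enumerate the integers up to `M` in decreasing order. -/
def natEquivIic (M : ℤ) : ℕ ≃ Iic M where
  toFun k := ⟨M - k, by simp⟩
  invFun m := (M - m).toNat
  left_inv k := by simp
  right_inv m := by
    have := m.2
    simp only [mem_Iic] at this
    ext
    simp only [Int.ofNat_toNat]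
    omega

/-- Negation exchanges the integers from `M` on and those up to `-M`. -/
def negEquivIciIic (M : ℤ) : Ici M ≃ Iic (-M) where
  toFun m := ⟨-m, mem_Iic.2 (neg_le_neg m.2)⟩
  invFun m := ⟨-m, mem_Ici.2 (le_neg.2 m.2)⟩
  left_inv m := by simp
  right_inv m := by simp

lemma hasSum_imageTerm_Iic {β d ξ η : ℝ} (hβ : 0 < β) (hd : 0 < d) {t s : Plane} {M n : ℤ}
    (h : 0 < t 0 - s 0 - n * ξ - M * d) :
    HasSum (fun m : Iic M => imageTerm β d ξ η t s m n)
      (∫ μ in Ioi 0, planeWave β d (t 0 - s 0 - n * ξ - M * d) (t 1 - s 1 - n * η) μ).re := by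
  rw [← (natEquivIic M).hasSum_iff]
  convert hasSum_integral_planeWave hβ hd h (t 1 - s 1 - n * η) using 2 with k
  -- Every image with m ≤ M lies strictly west of the target, as the Sommerfeld formula requires.
  have hlt : (s + latticePoint d ξ η (M - k) n) 0 < t 0 := by
    simp only [PiLp.add_apply, latticePoint_zero]
    push_cast
    nlinarith [mul_nonneg k.cast_nonneg hd.le]
  simp only [Function.comp, natEquivIic, Equiv.coe_fn_mk, imageTerm]
  rw [green_eq_integral hβ hlt]
  simp only [PiLp.add_apply, latticePoint_zero, latticePoint_one]
  push_cast
  congr 1 with μ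
  congr 3
  · ring
  · ring

lemma hasSum_imageTerm_Ici {β d ξ η : ℝ} (hβ : 0 < β) (hd : 0 < d) {t s : Plane} {M n : ℤ}
    (h : 0 < s 0 - t 0 + n * ξ + M * d) :
    HasSum (fun m : Ici M => imageTerm β d ξ η t s m n)
      (∫ μ in Ioi 0, planeWave β d (s 0 - t 0 + n * ξ + M * d) (s 1 - t 1 + n * η) μ).re := by
  have h' : 0 < s 0 - t 0 - ((-n : ℤ) : ℝ) * ξ - ((-M : ℤ) : ℝ) * d := by
    push_cast; linarith
  have key := hasSum_imageTerm_Iic (η := η) hβ hd h'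
  rw [← (negEquivIciIic M).hasSum_iff] at key
  convert key using 1
  · ext m
    exact imageTerm_comm _ _ _ _ _ _ _ _
  · push_cast
    simp only [neg_mul, sub_neg_eq_add]

/-! ### Existence of quadratures -/

/-- Hahn–Banach: a functional separating the integral from the closed span would vanish on the span,
hence on every value of Φ, hence on the integral. -/
lemma integral_mem_topologicalClosure_span {E : Type*} [NormedAddCommGroup E] [NormedSpace ℝ E]
    [CompleteSpace E] {Φ : ℝ → E} (hΦ : IntegrableOn Φ (Ioi 0)) :
    ∫ μ in Ioi 0, Φ μ ∈ (Submodule.span ℝ (Φ '' Ici 0)).topologicalClosure := by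
  set S := (Submodule.span ℝ (Φ '' Ici 0)).topologicalClosure
  by_contra hI
  obtain ⟨f, u, hfS, hfI⟩ := geometric_hahn_banach_closed_point S.convex
    (Submodule.isClosed_topologicalClosure _) hI
  have hf0 : ∀ a ∈ S, f a = 0 := by
    intro a ha
    by_contra h
    -- A functional bounded above on a subspace vanishes there: rescaling a so that f takes the
    -- value u would contradict f < u.
    have := hfS _ (S.smul_mem (u / f a) ha)
    rw [map_smul, smul_eq_mul, div_mul_cancel₀ _ h] at this
    exact this.false
  have h0 : 0 < u := by simpa using hfS 0 S.zero_mem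
  rw [← ContinuousLinearMap.integral_comp_comm f hΦ, setIntegral_congr_fun (g := fun _ => (0 : ℝ))
    measurableSet_Ioi] at hfI
  · simp only [integral_zero] at hfI
    exact hfI.not_gt h0
  · intro μ hμ
    exact hf0 _ (Submodule.le_topologicalClosure _
      (Submodule.subset_span (mem_image_of_mem _ (mem_Ici.2 (le_of_lt hμ)))))

lemma exists_quadrature {E : Type*} [NormedAddCommGroup E] [NormedSpace ℝ E]
    [CompleteSpace E] {Φ : ℝ → E} (hΦ : IntegrableOn Φ (Ioi 0)) {ε : ℝ} (hε : 0 < ε) :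
    ∃ (N : ℕ) (lam w : Fin N → ℝ), (∀ n, 0 ≤ lam n) ∧
      ‖(∫ μ in Ioi 0, Φ μ) - ∑ n, w n • Φ (lam n)‖ ≤ ε := by
  obtain ⟨v, hv, hdist⟩ := Metric.mem_closure_iff.1
    (integral_mem_topologicalClosure_span hΦ) ε hε
  obtain ⟨N, w, g, rfl⟩ := Submodule.mem_span_set'.1 hv
  choose lam hlam hg using fun i => (g i).2
  refine ⟨N, lam, w, hlam, ?_⟩
  simp only [hg, ← dist_eq_norm]
  exact hdist.le

/-- A quadrature for the plane waves with offsets in a rectangle `[c, C] × [-M, M]`, `c > 0`. -/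
lemma exists_quadrature_planeWave {β d c : ℝ} (hβ : 0 < β) (hd : 0 < d) (hc : 0 < c) (C M : ℝ)
    {ε : ℝ} (hε : 0 < ε) :
    ∃ (N : ℕ) (lam w : Fin N → ℝ), (∀ n, 0 ≤ lam n) ∧
      ∀ X ∈ Icc c C, ∀ Y ∈ Icc (-M) M,
        |(∫ μ in Ioi 0, planeWave β d X Y μ).re
          - (∑ n, (w n : ℂ) * planeWave β d X Y (lam n)).re| ≤ ε := by
  let K := Icc c C ×ˢ Icc (-M) M
  have : CompactSpace K := isCompact_iff_compactSpace.1 (isCompact_Icc.prod isCompact_Icc)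
  have hcont : Continuous fun p : ℝ × K =>
      waveAmplitude β d p.2.1.1 p.1 * Real.cos (p.1 * p.2.1.2) :=
    ((continuous_waveAmplitude_uncurry hβ hd).comp (by fun_prop :
      Continuous fun p : ℝ × K => (p.2.1.1, p.1))).mul (by fun_prop)
  -- The real part of the wave at frequency μ, viewed as a function of its offset. The sup norm
  -- makes the resulting quadrature uniform in the offset.
  let Φ : C(ℝ, C(K, ℝ)) := ContinuousMap.curry ⟨_, hcont⟩
  have hΦ : ∀ μ (p : K), Φ μ p = waveAmplitude β d p.1.1 μ * Real.cos (μ * p.1.2) :=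
    fun _ _ => rfl
  have hint : IntegrableOn Φ (Ioi 0) := by
    refine Integrable.mono' ((exp_neg_integrableOn_Ioi 0 hc).const_mul
      (1 / (2 * Real.pi * β * (1 - Real.exp (-β * d)))))
      Φ.continuous.aestronglyMeasurable (ae_of_all _ fun μ => ?_)
    have hnn : 0 ≤ 1 / (2 * Real.pi * β * (1 - Real.exp (-β * d))) * Real.exp (-c * μ) :=
      (waveAmplitude_nonneg hβ hd c μ).trans (waveAmplitude_le hβ hd hc le_rfl)
    refine (ContinuousMap.norm_le _ hnn).2 fun p => ?_
    have hA := waveAmplitude_nonneg hβ hd p.1.1 μ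
    rw [hΦ, norm_mul, Real.norm_of_nonneg hA]
    exact (mul_le_of_le_one_right hA (Real.abs_cos_le_one _)).trans
      (waveAmplitude_le hβ hd hc p.2.1.1)
  obtain ⟨N, lam, w, hlam, h⟩ := exists_quadrature hint hε
  refine ⟨N, lam, w, hlam, fun X hX Y hY => ?_⟩
  have hp := (ContinuousMap.norm_coe_le_norm _ (⟨(X, Y), hX, hY⟩ : K)).trans h
  rw [ContinuousMap.sub_apply, ContinuousMap.integral_apply hint, ContinuousMap.sum_apply] at hp
  simpa only [integral_re_planeWave hβ hd (hc.trans_le hX.1), Complex.re_sum,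
    Complex.re_ofReal_mul, re_planeWave, hΦ, ContinuousMap.smul_apply, smul_eq_mul,
    Real.norm_eq_abs] using hp

/-! ### The integrands and the factorizations -/

lemma westIntegrand1_eq (β d : ℝ) (t s : Plane) (μ : ℝ) :
    westIntegrand1 β d t s μ = planeWave β d (t 0 - s 0 + 2 * d) (t 1 - s 1) μ := by
  rw [westIntegrand1, planeWave, waveAmplitude, geomFactor, Complex.real_smul,
    mul_right_comm, ← Complex.ofReal_mul]
  congr 2
  rw [show -(chi β μ) * (t 0 - s 0 + 2 * d) =
    -(chi β μ) * (t 0 - s 0) + -((2 : ℕ) : ℝ) * chi β μ * d by push_cast; ring, Real.exp_add]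
  ring

/-- With (a, b) = ±(ξ, η) the multiplier is one of the two exponentials in B, so multiplication by B
adds waves at shifted offsets. -/
lemma planeWave_add (β d X Y a b μ : ℝ) :
    planeWave β d (X + a) (Y + b) μ =
      Complex.exp (-((chi β μ : ℝ) : ℂ) * a + Complex.I * μ * b) * planeWave β d X Y μ := by
  simp only [planeWave, waveAmplitude, Complex.real_smul]
  push_cast
  rw [mul_add, mul_add, Complex.exp_add, Complex.exp_add, Complex.exp_add]
  ring

lemma westIntegrand2_eq (β d ξ η : ℝ) (t s : Plane) (μ : ℝ) :
    westIntegrand2 β d ξ η t s μ =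
      planeWave β d (t 0 - s 0 + 4 * d + ξ) (t 1 - s 1 + η) μ
      + planeWave β d (t 0 - s 0 + 4 * d - ξ) (t 1 - s 1 - η) μ
      + planeWave β d (t 0 - s 0 + 4 * d) (t 1 - s 1) μ := by
  have h : ((Real.exp (-(chi β μ) * (t 0 - s 0)) / (2 * Real.pi * chi β μ) : ℝ) : ℂ)
    * Complex.exp (Complex.I * μ * ((t 1 - s 1 : ℝ) : ℂ))
    * (geomFactor β d 4 μ : ℂ) = planeWave β d (t 0 - s 0 + 4 * d) (t 1 - s 1) μ := by
    rw [planeWave, waveAmplitude, geomFactor, Complex.real_smul,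
      mul_right_comm, ← Complex.ofReal_mul]
    congr 2
    rw [show -(chi β μ) * (t 0 - s 0 + 4 * d) =
      -(chi β μ) * (t 0 - s 0) + -((4 : ℕ) : ℝ) * chi β μ * d by push_cast; ring, Real.exp_add]
    ring
  rw [westIntegrand2, h, planeWave_add, sub_eq_add_neg _ ξ, sub_eq_add_neg _ η, planeWave_add,
    rowFactor, show -((chi β μ : ℝ) : ℂ) * ((-ξ : ℝ) : ℂ) + Complex.I * μ * ((-η : ℝ) : ℂ)
      = ((chi β μ : ℝ) : ℂ) * ξ - Complex.I * μ * η by push_cast; ring]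
  ring

lemma west1_factorization {NT NS N : ℕ} (β d : ℝ) (lam w : Fin N → ℝ) (T : Fin NT → Plane)
    (S : Fin NS → Plane) (l : Fin NT) (j : Fin NS) :
    (Lwest β lam T * D1 β d lam w * Rwest β lam S) l j =
      ∑ n, (w n : ℂ) * westIntegrand1 β d (T l) (S j) (lam n) := by
  rw [Matrix.mul_apply]
  refine Finset.sum_congr rfl fun n _ => ?_
  rw [D1, Matrix.mul_diagonal]
  simp only [Lwest, Rwest, Matrix.of_apply, westIntegrand1]
  push_cast
  rw [mul_sub, mul_sub, sub_eq_add_neg, sub_eq_add_neg, Complex.exp_add, Complex.exp_add]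
  simp only [neg_mul, neg_neg]
  ring

lemma west2_factorization {NT NS N : ℕ} (β d ξ η : ℝ) (lam w : Fin N → ℝ) (T : Fin NT → Plane)
    (S : Fin NS → Plane) (l : Fin NT) (j : Fin NS) :
    (Lwest β lam T * D2west β d ξ η lam w * Rwest β lam S) l j =
      ∑ n, (w n : ℂ) * westIntegrand2 β d ξ η (T l) (S j) (lam n) := by
  rw [Matrix.mul_apply]
  refine Finset.sum_congr rfl fun n _ => ?_
  rw [D2west, Matrix.mul_diagonal]
  simp only [Lwest, Rwest, Matrix.of_apply, westIntegrand2]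
  push_cast
  rw [mul_sub, mul_sub, sub_eq_add_neg, sub_eq_add_neg, Complex.exp_add, Complex.exp_add]
  simp only [neg_mul, neg_neg]
  ring

/-- East factors are the conjugate transposes of west factors with the roles of targets and
sources exchanged. -/
lemma Least_eq_conjTranspose {NT N : ℕ} (β : ℝ) (lam : Fin N → ℝ) (T : Fin NT → Plane) :
    Least β lam T = (Rwest β lam T)ᴴ := by
  ext l n
  simp [Least, Rwest, ← Complex.exp_conj]

lemma Reast_eq_conjTranspose {NS N : ℕ} (β : ℝ) (lam : Fin N → ℝ) (S : Fin NS → Plane) :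
    Reast β lam S = (Lwest β lam S)ᴴ := by
  ext n j
  simp [Reast, Lwest, ← Complex.exp_conj]

lemma D1_conjTranspose {N : ℕ} (β d : ℝ) (lam w : Fin N → ℝ) :
    (D1 β d lam w)ᴴ = D1 β d lam w := by
  rw [D1, Matrix.diagonal_conjTranspose]
  congr 1
  ext n
  simp only [Pi.star_apply, RCLike.star_def, Complex.conj_ofReal]

lemma D2west_conjTranspose {N : ℕ} (β d ξ η : ℝ) (lam w : Fin N → ℝ) :
    (D2west β d ξ η lam w)ᴴ = D2east β d ξ η lam w := by
  rw [D2east, D2west, Matrix.diagonal_conjTranspose, Matrix.diagonal_map (map_zero _)]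
  rfl

lemma east1_eq_conjTranspose {NT NS N : ℕ} (β d : ℝ) (lam w : Fin N → ℝ) (T : Fin NT → Plane)
    (S : Fin NS → Plane) :
    Least β lam T * D1 β d lam w * Reast β lam S =
      (Lwest β lam S * D1 β d lam w * Rwest β lam T)ᴴ := by
  rw [Matrix.conjTranspose_mul, Matrix.conjTranspose_mul, D1_conjTranspose, Matrix.mul_assoc,
    Least_eq_conjTranspose, Reast_eq_conjTranspose]

lemma east2_eq_conjTranspose {NT NS N : ℕ} (β d ξ η : ℝ) (lam w : Fin N → ℝ)
    (T : Fin NT → Plane) (S : Fin NS → Plane) :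
    Least β lam T * D2east β d ξ η lam w * Reast β lam S =
      (Lwest β lam S * D2west β d ξ η lam w * Rwest β lam T)ᴴ := by
  rw [Matrix.conjTranspose_mul, Matrix.conjTranspose_mul, D2west_conjTranspose, Matrix.mul_assoc,
    Least_eq_conjTranspose, Reast_eq_conjTranspose]

/-- The charges are real, so taking real parts commutes with the product and the entrywise errors
add with weights |q_j|. -/
lemma representsRe_of_forall_entry {NT NS : ℕ} {P : Matrix (Fin NT) (Fin NS) ℝ}
    {A : Matrix (Fin NT) (Fin NS) ℂ} {ε : ℝ} (h : ∀ l j, |P l j - (A l j).re| ≤ ε) :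
    RepresentsRe P A ε := by
  refine ⟨h, fun q l => ?_⟩
  simp only [Matrix.mulVec, dotProduct, Complex.re_sum, Complex.re_mul_ofReal]
  rw [← Finset.sum_sub_distrib, Finset.mul_sum]
  refine (Finset.abs_sum_le_sum_abs _ _).trans (Finset.sum_le_sum fun j _ => ?_)
  rw [← sub_mul, abs_mul]
  exact mul_le_mul_of_nonneg_right (h l j) (abs_nonneg _)

/-! ### Offsets within the cell -/

lemma unitCell_sub_bounds {d ξ η : ℝ} (hd : 0 < d) (hη : 0 < η) {t s : Plane}
    (ht : t ∈ unitCell d ξ η) (hs : s ∈ unitCell d ξ η) :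
    |t 0 - s 0| ≤ d + |ξ| ∧ |t 1 - s 1| ≤ η := by
  obtain ⟨a, ha, b, hb, rfl⟩ := ht
  obtain ⟨a', ha', b', hb', rfl⟩ := hs
  have h1 : |a - a'| ≤ 1 := abs_le.2 ⟨by linarith [ha.1, ha'.2], by linarith [ha.2, ha'.1]⟩
  have h2 : |b - b'| ≤ 1 := abs_le.2 ⟨by linarith [hb.1, hb'.2], by linarith [hb.2, hb'.1]⟩
  simp only [e₁, e₂, PiLp.add_apply, PiLp.smul_apply, smul_eq_mul,
    Matrix.cons_val_zero, Matrix.cons_val_one]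
  constructor
  · calc _ = |(a - a') * d + (b - b') * ξ| := by ring_nf
      _ ≤ |a - a'| * |d| + |b - b'| * |ξ| := by
        rw [← abs_mul, ← abs_mul]; exact abs_add_le _ _
      _ ≤ 1 * d + 1 * |ξ| := by
        rw [abs_of_pos hd]; gcongr
      _ = _ := by ring
  · calc _ = |b - b'| * η := by
          rw [← abs_of_pos hη, ← abs_mul, abs_of_pos hη]; ring_nf
      _ ≤ 1 * η := by gcongr
      _ = η := one_mul η

lemma abs_lt_of_sqrt_le {d ξ η : ℝ} (hη : 0 < η) (h : Real.sqrt (ξ ^ 2 + η ^ 2) ≤ d) :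
    |ξ| < d := by
  refine lt_of_lt_of_le (Real.lt_sqrt_of_sq_lt ?_) h
  rw [sq_abs]
  nlinarith

lemma singly_offset_mem {d η : ℝ} (hd : 0 < d) (hη : 0 < η) {t s : Plane}
    (ht : t ∈ unitCell d 0 η) (hs : s ∈ unitCell d 0 η) :
    t 0 - s 0 + 2 * d ∈ Icc d (3 * d) ∧ t 1 - s 1 ∈ Icc (-η) η := by
  obtain ⟨h0, h1⟩ := unitCell_sub_bounds hd hη ht hs
  rw [abs_zero, add_zero] at h0
  rw [abs_le] at h0 h1
  exact ⟨⟨by linarith, by linarith⟩, h1⟩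

/-- Since |ξ| < d, |x - x'| ≤ d + |ξ| < 2d, and the row shift costs less than d more. Starting at 4d
thus leaves a gap of at least d and at most 7d, with bounds free of ξ. -/
lemma doubly_offset_mem {d ξ η : ℝ} (hd : 0 < d) (hη : 0 < η)
    (hξ : Real.sqrt (ξ ^ 2 + η ^ 2) ≤ d) {t s : Plane}
    (ht : t ∈ unitCell d ξ η) (hs : s ∈ unitCell d ξ η) {σ : ℝ} (hσ : |σ| ≤ 1) :
    t 0 - s 0 + 4 * d + σ * ξ ∈ Icc d (7 * d) ∧
      t 1 - s 1 + σ * η ∈ Icc (-(2 * η)) (2 * η) := by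
  obtain ⟨h0, h1⟩ := unitCell_sub_bounds hd hη ht hs
  have h2 := abs_lt_of_sqrt_le hη hξ
  have h3 : |σ * ξ| ≤ |ξ| := by
    rw [abs_mul]; exact mul_le_of_le_one_left (abs_nonneg _) hσ
  have h4 : |σ * η| ≤ η := by
    rw [abs_mul, abs_of_pos hη]; exact mul_le_of_le_one_left hη.le hσ
  rw [abs_le] at h0 h1 h3 h4
  exact ⟨⟨by linarith, by linarith⟩, ⟨by linarith, by linarith⟩⟩

/-! ### The singly periodic case -/

section Singly

variable {β d η : ℝ} {t s : Plane}

lemma integrableOn_westIntegrand1 (hβ : 0 < β) (hd : 0 < d) (hη : 0 < η)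
    (ht : t ∈ unitCell d 0 η) (hs : s ∈ unitCell d 0 η) :
    IntegrableOn (westIntegrand1 β d t s) (Ioi 0) := by
  rw [show westIntegrand1 β d t s = _ from funext (westIntegrand1_eq β d t s)]
  exact integrableOn_planeWave hβ hd (hd.trans_le (singly_offset_mem hd hη ht hs).1.1) _

lemma hasSum_K1west (hβ : 0 < β) (hd : 0 < d) (hη : 0 < η)
    (ht : t ∈ unitCell d 0 η) (hs : s ∈ unitCell d 0 η) :
    HasSum (fun m : Iic (-2 : ℤ) => green β t (s + ((m : ℤ) : ℝ) • e₁ d))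
      (∫ μ in Ioi 0, westIntegrand1 β d t s μ).re := by
  have hX := hd.trans_le (singly_offset_mem hd hη ht hs).1.1
  -- The single row is n = 0 of a lattice whose second vector is irrelevant, so ξ = η = 0 will do.
  have h := hasSum_imageTerm_Iic (η := 0) (n := 0) (ξ := 0) (M := -2) (t := t) (s := s) hβ hd
    (by push_cast; linarith)
  simp only [green_add_smul_e₁, westIntegrand1_eq]
  convert h using 5 <;> push_cast <;> ring

lemma hasSum_K1east (hβ : 0 < β) (hd : 0 < d) (hη : 0 < η)
    (ht : t ∈ unitCell d 0 η) (hs : s ∈ unitCell d 0 η) :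
    HasSum (fun m : Ici (2 : ℤ) => green β t (s + ((m : ℤ) : ℝ) • e₁ d))
      (∫ μ in Ioi 0, westIntegrand1 β d s t μ).re := by
  have hX := hd.trans_le (singly_offset_mem hd hη hs ht).1.1
  have h := hasSum_imageTerm_Ici (η := 0) (n := 0) (ξ := 0) (M := 2) (t := t) (s := s) hβ hd
    (by push_cast; linarith)
  simp only [green_add_smul_e₁, westIntegrand1_eq]
  convert h using 5 <;> push_cast <;> ring

lemma exists_hasPrecision_westIntegrand1 (hβ : 0 < β) (hd : 0 < d) (hη : 0 < η) {ε : ℝ}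
    (hε : 0 < ε) :
    ∃ (N : ℕ) (lam w : Fin N → ℝ), (∀ n, 0 ≤ lam n) ∧
      HasPrecision (unitCell d 0 η) (westIntegrand1 β d) ε lam w := by
  obtain ⟨N, lam, w, hlam, h⟩ := exists_quadrature_planeWave hβ hd hd (3 * d) η hε
  refine ⟨N, lam, w, hlam, fun t ht s hs => ?_⟩
  obtain ⟨hX, hY⟩ := singly_offset_mem hd hη ht hs
  simpa only [westIntegrand1_eq] using h _ hX _ hY

variable {ε : ℝ} {N NT NS : ℕ} {lam w : Fin N → ℝ} {T : Fin NT → Plane} {S : Fin NS → Plane}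

lemma representsRe_K1west (hβ : 0 < β) (hd : 0 < d) (hη : 0 < η)
    (h : HasPrecision (unitCell d 0 η) (westIntegrand1 β d) ε lam w)
    (hT : ∀ l, T l ∈ unitCell d 0 η) (hS : ∀ j, S j ∈ unitCell d 0 η) :
    RepresentsRe (kernelMatrix (K1west β d) T S)
      (Lwest β lam T * D1 β d lam w * Rwest β lam S) ε := by
  refine representsRe_of_forall_entry fun l j => ?_
  rw [west1_factorization, kernelMatrix, Matrix.of_apply, K1west,
    (hasSum_K1west hβ hd hη (hT l) (hS j)).tsum_eq]
  exact h _ (hT l) _ (hS j)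

lemma representsRe_K1east (hβ : 0 < β) (hd : 0 < d) (hη : 0 < η)
    (h : HasPrecision (unitCell d 0 η) (westIntegrand1 β d) ε lam w)
    (hT : ∀ l, T l ∈ unitCell d 0 η) (hS : ∀ j, S j ∈ unitCell d 0 η) :
    RepresentsRe (kernelMatrix (K1east β d) T S)
      (Least β lam T * D1 β d lam w * Reast β lam S) ε := by
  refine representsRe_of_forall_entry fun l j => ?_
  rw [east1_eq_conjTranspose, Matrix.conjTranspose_apply, west1_factorization, RCLike.star_def,
    Complex.conj_re, kernelMatrix, Matrix.of_apply, K1east,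
    (hasSum_K1east hβ hd hη (hT l) (hS j)).tsum_eq]
  exact h _ (hS j) _ (hT l)

end Singly

/-! ### The doubly periodic case -/

section Doubly

variable {β d ξ η : ℝ} {t s : Plane}

lemma westIntegrand2_eq_sum (β d ξ η : ℝ) (t s : Plane) (μ : ℝ) :
    westIntegrand2 β d ξ η t s μ = ∑ n ∈ Finset.Icc (-1 : ℤ) 1,
      planeWave β d (t 0 - s 0 + 4 * d + (n : ℝ) * ξ) (t 1 - s 1 + (n : ℝ) * η) μ := by
  rw [westIntegrand2_eq, show Finset.Icc (-1 : ℤ) 1 = {-1, 0, 1} by decide,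
    Finset.sum_insert (by decide), Finset.sum_insert (by decide), Finset.sum_singleton]
  simp only [Int.cast_neg, Int.cast_one, Int.cast_zero, neg_mul, one_mul, zero_mul, add_zero,
    ← sub_eq_add_neg]
  ring

lemma abs_cast_le_one_of_mem_Icc {n : ℤ} (hn : n ∈ Finset.Icc (-1 : ℤ) 1) : |(n : ℝ)| ≤ 1 := by
  rw [Finset.mem_Icc] at hn
  exact_mod_cast abs_le.2 hn

lemma doubly_offset_pos (hd : 0 < d) (hη : 0 < η) (hξ : Real.sqrt (ξ ^ 2 + η ^ 2) ≤ d)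
    (ht : t ∈ unitCell d ξ η) (hs : s ∈ unitCell d ξ η) {n : ℤ}
    (hn : n ∈ Finset.Icc (-1 : ℤ) 1) : 0 < t 0 - s 0 + 4 * d + (n : ℝ) * ξ :=
  hd.trans_le (doubly_offset_mem hd hη hξ ht hs (abs_cast_le_one_of_mem_Icc hn)).1.1

lemma integrableOn_westIntegrand2 (hβ : 0 < β) (hd : 0 < d) (hη : 0 < η)
    (hξ : Real.sqrt (ξ ^ 2 + η ^ 2) ≤ d)
    (ht : t ∈ unitCell d ξ η) (hs : s ∈ unitCell d ξ η) :
    IntegrableOn (westIntegrand2 β d ξ η t s) (Ioi 0) := by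
  rw [show westIntegrand2 β d ξ η t s = _ from funext (westIntegrand2_eq_sum β d ξ η t s)]
  exact integrable_finsetSum _ fun n hn =>
    integrableOn_planeWave hβ hd (doubly_offset_pos hd hη hξ ht hs hn) _

lemma re_integral_westIntegrand2 (hβ : 0 < β) (hd : 0 < d) (hη : 0 < η)
    (hξ : Real.sqrt (ξ ^ 2 + η ^ 2) ≤ d)
    (ht : t ∈ unitCell d ξ η) (hs : s ∈ unitCell d ξ η) :
    (∫ μ in Ioi 0, westIntegrand2 β d ξ η t s μ).re = ∑ n ∈ Finset.Icc (-1 : ℤ) 1,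
      (∫ μ in Ioi 0, planeWave β d (t 0 - s 0 + 4 * d + (n : ℝ) * ξ)
        (t 1 - s 1 + (n : ℝ) * η) μ).re := by
  simp only [westIntegrand2_eq_sum]
  rw [integral_finsetSum _ fun n hn =>
    integrableOn_planeWave hβ hd (doubly_offset_pos hd hη hξ ht hs hn) _, Complex.re_sum]

/-- The image shift enters t - (s + l) with a minus sign, so the wave shifted by +n(ξ, η) comes from
row -n. In the east case exchanging t and s removes this flip. -/
lemma hasSum_K2west_row (hβ : 0 < β) (hd : 0 < d) (hη : 0 < η)
    (hξ : Real.sqrt (ξ ^ 2 + η ^ 2) ≤ d)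
    (ht : t ∈ unitCell d ξ η) (hs : s ∈ unitCell d ξ η) {n : ℤ}
    (hn : n ∈ Finset.Icc (-1 : ℤ) 1) :
    HasSum (fun m : Iic (-4 : ℤ) => imageTerm β d ξ η t s m (-n))
      (∫ μ in Ioi 0, planeWave β d (t 0 - s 0 + 4 * d + (n : ℝ) * ξ)
        (t 1 - s 1 + (n : ℝ) * η) μ).re := by
  have hX := doubly_offset_pos hd hη hξ ht hs hn
  have h := hasSum_imageTerm_Iic (η := η) (n := -n) (ξ := ξ) (M := -4) (t := t) (s := s) hβ hd
    (by push_cast; linarith)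
  convert h using 5 <;> push_cast <;> ring

lemma hasSum_K2east_row (hβ : 0 < β) (hd : 0 < d) (hη : 0 < η)
    (hξ : Real.sqrt (ξ ^ 2 + η ^ 2) ≤ d)
    (ht : t ∈ unitCell d ξ η) (hs : s ∈ unitCell d ξ η) {n : ℤ}
    (hn : n ∈ Finset.Icc (-1 : ℤ) 1) :
    HasSum (fun m : Ici (4 : ℤ) => imageTerm β d ξ η t s m n)
      (∫ μ in Ioi 0, planeWave β d (s 0 - t 0 + 4 * d + (n : ℝ) * ξ)
        (s 1 - t 1 + (n : ℝ) * η) μ).re := by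
  have hX := doubly_offset_pos hd hη hξ hs ht hn
  have h := hasSum_imageTerm_Ici (η := η) (n := n) (ξ := ξ) (M := 4) (t := t) (s := s) hβ hd
    (by push_cast; linarith)
  convert h using 5; push_cast; ring

lemma neg_mem_Icc_neg_one_one {n : ℤ} (hn : n ∈ Finset.Icc (-1 : ℤ) 1) :
    -n ∈ Finset.Icc (-1 : ℤ) 1 := by
  rw [Finset.mem_Icc] at hn ⊢
  omega

lemma K2west_eq_integral (hβ : 0 < β) (hd : 0 < d) (hη : 0 < η)
    (hξ : Real.sqrt (ξ ^ 2 + η ^ 2) ≤ d)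
    (ht : t ∈ unitCell d ξ η) (hs : s ∈ unitCell d ξ η) :
    K2west β d ξ η t s = (∫ μ in Ioi 0, westIntegrand2 β d ξ η t s μ).re := by
  rw [re_integral_westIntegrand2 hβ hd hη hξ ht hs, K2west]
  refine Finset.sum_bij' (fun n _ => -n) (fun n _ => -n) (fun _ => neg_mem_Icc_neg_one_one)
    (fun _ => neg_mem_Icc_neg_one_one) (fun n _ => neg_neg n) (fun n _ => neg_neg n) fun n hn => ?_
  rw [← (hasSum_K2west_row hβ hd hη hξ ht hs (neg_mem_Icc_neg_one_one hn)).tsum_eq]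
  simp only [neg_neg]

lemma K2east_eq_integral (hβ : 0 < β) (hd : 0 < d) (hη : 0 < η)
    (hξ : Real.sqrt (ξ ^ 2 + η ^ 2) ≤ d)
    (ht : t ∈ unitCell d ξ η) (hs : s ∈ unitCell d ξ η) :
    K2east β d ξ η t s = (∫ μ in Ioi 0, westIntegrand2 β d ξ η s t μ).re := by
  rw [re_integral_westIntegrand2 hβ hd hη hξ hs ht, K2east]
  exact Finset.sum_congr rfl fun n hn => (hasSum_K2east_row hβ hd hη hξ ht hs hn).tsum_eq

lemma exists_hasPrecision_westIntegrand2 (hβ : 0 < β) (hd : 0 < d) (hη : 0 < η) {ε : ℝ}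
    (hε : 0 < ε) :
    ∃ (N : ℕ) (lam w : Fin N → ℝ), (∀ n, 0 ≤ lam n) ∧
      ∀ ξ : ℝ, Real.sqrt (ξ ^ 2 + η ^ 2) ≤ d →
        HasPrecision (unitCell d ξ η) (westIntegrand2 β d ξ η) ε lam w := by
  -- Each of the three rows receives a third of the error. The rectangle depends only on d and η, so
  -- the rule is fixed before ξ.
  obtain ⟨N, lam, w, hlam, h⟩ := exists_quadrature_planeWave hβ hd hd (7 * d) (2 * η)
    (show 0 < ε / 3 by positivity)
  refine ⟨N, lam, w, hlam, fun ξ hξ t ht s hs => ?_⟩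
  rw [re_integral_westIntegrand2 hβ hd hη hξ ht hs]
  simp only [westIntegrand2_eq_sum, Finset.mul_sum]
  rw [Finset.sum_comm, Complex.re_sum, ← Finset.sum_sub_distrib]
  refine (Finset.abs_sum_le_sum_abs _ _).trans ((Finset.sum_le_card_nsmul _ _ (ε / 3)
    fun n hn => ?_).trans_eq ?_)
  · obtain ⟨hX, hY⟩ := doubly_offset_mem hd hη hξ ht hs (abs_cast_le_one_of_mem_Icc hn)
    exact h _ hX _ hY
  · rw [show (Finset.Icc (-1 : ℤ) 1).card = 3 by decide, nsmul_eq_mul]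
    push_cast
    ring

variable {ε : ℝ} {N NT NS : ℕ} {lam w : Fin N → ℝ} {T : Fin NT → Plane} {S : Fin NS → Plane}

lemma representsRe_K2west (hβ : 0 < β) (hd : 0 < d) (hη : 0 < η)
    (hξ : Real.sqrt (ξ ^ 2 + η ^ 2) ≤ d)
    (h : HasPrecision (unitCell d ξ η) (westIntegrand2 β d ξ η) ε lam w)
    (hT : ∀ l, T l ∈ unitCell d ξ η) (hS : ∀ j, S j ∈ unitCell d ξ η) :
    RepresentsRe (kernelMatrix (K2west β d ξ η) T S)
      (Lwest β lam T * D2west β d ξ η lam w * Rwest β lam S) ε := by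
  refine representsRe_of_forall_entry fun l j => ?_
  rw [west2_factorization, kernelMatrix, Matrix.of_apply,
    K2west_eq_integral hβ hd hη hξ (hT l) (hS j)]
  exact h _ (hT l) _ (hS j)

lemma representsRe_K2east (hβ : 0 < β) (hd : 0 < d) (hη : 0 < η)
    (hξ : Real.sqrt (ξ ^ 2 + η ^ 2) ≤ d)
    (h : HasPrecision (unitCell d ξ η) (westIntegrand2 β d ξ η) ε lam w)
    (hT : ∀ l, T l ∈ unitCell d ξ η) (hS : ∀ j, S j ∈ unitCell d ξ η) :
    RepresentsRe (kernelMatrix (K2east β d ξ η) T S)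
      (Least β lam T * D2east β d ξ η lam w * Reast β lam S) ε := by
  refine representsRe_of_forall_entry fun l j => ?_
  rw [east2_eq_conjTranspose, Matrix.conjTranspose_apply, west2_factorization, RCLike.star_def,
    Complex.conj_re, kernelMatrix, Matrix.of_apply, K2east_eq_integral hβ hd hη hξ (hT l) (hS j)]
  exact h _ (hS j) _ (hT l)

end Doubly

end PeriodicHelmholtz

end

theorem mainTheorem3 (β d η : ℝ) (hβ : 0 < β) (hd : 0 < d) (hη : 0 < η) :
    -- singly periodic case: rectangular cell of dimension d × η
    ((∀ t ∈ PeriodicHelmholtz.unitCell d 0 η, ∀ s ∈ PeriodicHelmholtz.unitCell d 0 η,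
        Summable (fun m : Set.Iic (-2 : ℤ) =>
          PeriodicHelmholtz.green β t (s + ((m : ℤ) : ℝ) • PeriodicHelmholtz.e₁ d)) ∧
        Summable (fun m : Set.Ici (2 : ℤ) =>
          PeriodicHelmholtz.green β t (s + ((m : ℤ) : ℝ) • PeriodicHelmholtz.e₁ d)) ∧
        MeasureTheory.IntegrableOn (PeriodicHelmholtz.westIntegrand1 β d t s)
          (Set.Ioi (0 : ℝ))) ∧
      (∀ ε : ℝ, 0 < ε → ∃ (N : ℕ) (lam w : Fin N → ℝ), (∀ n, 0 ≤ lam n) ∧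
        PeriodicHelmholtz.HasPrecision (PeriodicHelmholtz.unitCell d 0 η)
          (PeriodicHelmholtz.westIntegrand1 β d) ε lam w) ∧
      (∀ (ε : ℝ) (N : ℕ) (lam w : Fin N → ℝ), 0 < ε →
        PeriodicHelmholtz.HasPrecision (PeriodicHelmholtz.unitCell d 0 η)
          (PeriodicHelmholtz.westIntegrand1 β d) ε lam w →
        ∀ (NT NS : ℕ) (T : Fin NT → PeriodicHelmholtz.Plane)
          (S : Fin NS → PeriodicHelmholtz.Plane),
          (∀ l, T l ∈ PeriodicHelmholtz.unitCell d 0 η) →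
          (∀ j, S j ∈ PeriodicHelmholtz.unitCell d 0 η) →
          PeriodicHelmholtz.RepresentsRe
            (PeriodicHelmholtz.kernelMatrix (PeriodicHelmholtz.K1west β d) T S)
            (PeriodicHelmholtz.Lwest β lam T * PeriodicHelmholtz.D1 β d lam w
              * PeriodicHelmholtz.Rwest β lam S) ε ∧
          PeriodicHelmholtz.RepresentsRe
            (PeriodicHelmholtz.kernelMatrix (PeriodicHelmholtz.K1east β d) T S)
            (PeriodicHelmholtz.Least β lam T * PeriodicHelmholtz.D1 β d lam w
              * PeriodicHelmholtz.Reast β lam S) ε)) ∧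
    -- doubly periodic case: parallelogram cell with d ≥ √(ξ² + η²)
    ((∀ ξ : ℝ, Real.sqrt (ξ ^ 2 + η ^ 2) ≤ d →
        ∀ t ∈ PeriodicHelmholtz.unitCell d ξ η, ∀ s ∈ PeriodicHelmholtz.unitCell d ξ η,
        (∀ n ∈ Finset.Icc (-1 : ℤ) 1,
          Summable (fun m : Set.Iic (-4 : ℤ) => PeriodicHelmholtz.imageTerm β d ξ η t s m n) ∧
          Summable (fun m : Set.Ici (4 : ℤ) => PeriodicHelmholtz.imageTerm β d ξ η t s m n)) ∧
        MeasureTheory.IntegrableOn (PeriodicHelmholtz.westIntegrand2 β d ξ η t s)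
          (Set.Ioi (0 : ℝ))) ∧
      -- the nodes and weights can be chosen independently of ξ
      (∀ ε : ℝ, 0 < ε → ∃ (N : ℕ) (lam w : Fin N → ℝ), (∀ n, 0 ≤ lam n) ∧
        ∀ ξ : ℝ, Real.sqrt (ξ ^ 2 + η ^ 2) ≤ d →
          PeriodicHelmholtz.HasPrecision (PeriodicHelmholtz.unitCell d ξ η)
            (PeriodicHelmholtz.westIntegrand2 β d ξ η) ε lam w) ∧
      (∀ ξ : ℝ, Real.sqrt (ξ ^ 2 + η ^ 2) ≤ d →
        ∀ (ε : ℝ) (N : ℕ) (lam w : Fin N → ℝ), 0 < ε →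
        PeriodicHelmholtz.HasPrecision (PeriodicHelmholtz.unitCell d ξ η)
          (PeriodicHelmholtz.westIntegrand2 β d ξ η) ε lam w →
        ∀ (NT NS : ℕ) (T : Fin NT → PeriodicHelmholtz.Plane)
          (S : Fin NS → PeriodicHelmholtz.Plane),
          (∀ l, T l ∈ PeriodicHelmholtz.unitCell d ξ η) →
          (∀ j, S j ∈ PeriodicHelmholtz.unitCell d ξ η) →
          PeriodicHelmholtz.RepresentsRe
            (PeriodicHelmholtz.kernelMatrix (PeriodicHelmholtz.K2west β d ξ η) T S)
            (PeriodicHelmholtz.Lwest β lam T * PeriodicHelmholtz.D2west β d ξ η lam w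
              * PeriodicHelmholtz.Rwest β lam S) ε ∧
          PeriodicHelmholtz.RepresentsRe
            (PeriodicHelmholtz.kernelMatrix (PeriodicHelmholtz.K2east β d ξ η) T S)
            (PeriodicHelmholtz.Least β lam T * PeriodicHelmholtz.D2east β d ξ η lam w
              * PeriodicHelmholtz.Reast β lam S) ε)) := by 
  open PeriodicHelmholtz in
  refine ⟨⟨fun t ht s hs => ⟨(hasSum_K1west hβ hd hη ht hs).summable,
      (hasSum_K1east hβ hd hη ht hs).summable, integrableOn_westIntegrand1 hβ hd hη ht hs⟩,
    fun ε hε => exists_hasPrecision_westIntegrand1 hβ hd hη hε,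
    fun ε N lam w _ h NT NS T S hT hS =>
      ⟨representsRe_K1west hβ hd hη h hT hS, representsRe_K1east hβ hd hη h hT hS⟩⟩,
    fun ξ hξ t ht s hs => ⟨fun n hn => ⟨?_, (hasSum_K2east_row hβ hd hη hξ ht hs hn).summable⟩,
      integrableOn_westIntegrand2 hβ hd hη hξ ht hs⟩,
    fun ε hε => exists_hasPrecision_westIntegrand2 hβ hd hη hε,
    fun ξ hξ ε N lam w _ h NT NS T S hT hS =>
      ⟨representsRe_K2west hβ hd hη hξ h hT hS, representsRe_K2east hβ hd hη hξ h hT hS⟩⟩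
  -- The west row lemma is stated for row -n, so it is applied at -n.
  simpa only [neg_neg] using
    (PeriodicHelmholtz.hasSum_K2west_row hβ hd hη hξ ht hs
      (PeriodicHelmholtz.neg_mem_Icc_neg_one_one hn)).summable
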